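/- Let $n\ge 0$ be an integer. For a unitary $g\in U(2^n)$ let $\omega(g):\rho\mapsto g\rho g^\dagger$, a real-linear map on the space $\mathcal H_n$ of Hermitian $2^n\times 2^n$ matrices. A superoperator is a real-linear map $\mathcal C:\mathcal H_n\to\mathcal H_n$; superoperators carry the inner product $\langle \mathcal D,\mathcal C\rangle=\sum_{P}\operatorname{tr}[\mathcal D(P)\,\mathcal C(P)]$, the sum running over the $4^n$ Pauli strings $P\in\{I,X,Y,Z\}^{\otimes n}$. For a probability measure $\mu$ on a group whose elements $g$ act by unitary channels $\omega(g)$, the twirling map is $$\Lambda(\mu):\ \mathcal C\longmapsto \int \omega(g^{-1})\circ\mathcal C\circ\omega(g)\,d\mu(g),$$ and $|||\cdot|||_2$ is the spectral norm (operator norm with respect to $\langle\cdot,\cdot\rangle$) of linear operators on superoperators. Let $\mathcal C(n)$ be the $n$-qubit Clifford group, i.e. the finite group of unitaries in $U(2^n)$ normalizing the Pauli group, modulo global phases (the channel $\omega(g)$ does not depend on the phase of $g$). Call a probability measure $\mu$ on a finite group $G$ with support $A=\{g:\mu(g)\neq 0\}$ strongly scrambling if $A$ is contained in no left or right coset of a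 proper subgroup of $G$ (equivalently, $A^{-1}A$ generates $G$). Theorem. If $\mu$ is a strongly scrambling probability measure on $\mathcal C(n)$, then $$|||\Lambda(\mu)-\Lambda(\mu_H)|||_2<1,$$ where $\mu_H$ is the Haar probability measure on $SU(2^n)$. -/

import Mathlib

open MeasureTheory

noncomputable section

namespace CliffordTwirl

/-! ### Scrambling measures on groups -/

section Scrambling

variable {G : Type*} [Group G]

/-- The set `A` is contained in no left coset `gH` and in no right coset `Hg` of a proper
subgroup `H` of `G`. -/
def InNoProperCoset (A : Set G) : Prop :=
  ∀ H : Subgroup G, H ≠ ⊤ → ∀ g : G,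
    ¬ A ⊆ {x | ∃ h ∈ H, x = g * h} ∧ ¬ A ⊆ {x | ∃ h ∈ H, x = h * g}

/-- Equivalent form of the coset condition: the quotients `a⁻¹ b`, `a, b ∈ A`, generate `G`. -/
theorem inNoProperCoset_iff (A : Set G) :
    InNoProperCoset A ↔ Subgroup.closure {x | ∃ a ∈ A, ∃ b ∈ A, x = a⁻¹ * b} = ⊤ := by
  constructor
  · intro h
    by_contra hne
    rcases A.eq_empty_or_nonempty with rfl | ⟨a, ha⟩
    · exact (h _ hne 1).1 (Set.empty_subset _)
    · exact (h _ hne a).1 fun b hb =>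
        ⟨a⁻¹ * b, Subgroup.subset_closure ⟨a, ha, b, hb, rfl⟩, by group⟩
  · intro h H hH g
    constructor
    · intro hA
      apply hH
      rw [eq_top_iff, ← h, Subgroup.closure_le]
      rintro x ⟨a, ha, b, hb, rfl⟩
      obtain ⟨c, hc, rfl⟩ := hA ha
      obtain ⟨d, hd, rfl⟩ := hA hb
      have : (g * c)⁻¹ * (g * d) = c⁻¹ * d := by group
      rw [this]
      exact H.mul_mem (H.inv_mem hc) hd
    · intro hA
      apply hH
      rw [eq_top_iff]
      intro y _
      have hle : Subgroup.closure {x | ∃ a ∈ A, ∃ b ∈ A, x = a⁻¹ * b} ≤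
          H.comap (MulAut.conj g).toMonoidHom := by
        rw [Subgroup.closure_le]
        rintro x ⟨a, ha, b, hb, rfl⟩
        obtain ⟨c, hc, rfl⟩ := hA ha
        obtain ⟨d, hd, rfl⟩ := hA hb
        have : g * ((c * g)⁻¹ * (d * g)) * g⁻¹ = c⁻¹ * d := by group
        simp only [SetLike.mem_coe, Subgroup.mem_comap, MulEquiv.coe_toMonoidHom,
          MulAut.conj_apply, this]
        exact H.mul_mem (H.inv_mem hc) hd
      rw [h] at hle
      have := hle (Subgroup.mem_top (g⁻¹ * y * g))
      simp only [Subgroup.mem_comap, MulEquiv.coe_toMonoidHom, MulAut.conj_apply] at this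
      have e : g * (g⁻¹ * y * g) * g⁻¹ = y := by group
      rwa [e] at this

/-- A measure on a (finite, discrete) group is strongly scrambling if its support
`{g | μ {g} ≠ 0}` is contained in no left or right coset of a proper subgroup. -/
def StronglyScrambling [MeasurableSpace G] (μ : Measure G) : Prop :=
  InNoProperCoset {g : G | μ {g} ≠ 0}

end Scrambling

/-! ### Qubits, Pauli strings, Hermitian matrices -/

/-- Complex matrices on `n` qubits; rows and columns are indexed by bit strings of length `n`. -/
abbrev QMatrix (n : ℕ) : Type := Matrix (Fin n → Fin 2) (Fin n → Fin 2) ℂ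

/-- The unitary group `U(2^n)`. -/
abbrev U (n : ℕ) : Type := Matrix.unitaryGroup (Fin n → Fin 2) ℂ

/-- The special unitary group `SU(2^n)`. -/
abbrev SU (n : ℕ) : Type := Matrix.specialUnitaryGroup (Fin n → Fin 2) ℂ

/-- The real vector space of Hermitian `2^n × 2^n` matrices. -/
abbrev Herm (n : ℕ) : Type := selfAdjoint (QMatrix n)

/-- The four single-qubit Pauli matrices `I, X, Y, Z`. -/
def pauli : Fin 4 → Matrix (Fin 2) (Fin 2) ℂ :=
  ![!![1, 0; 0, 1], !![0, 1; 1, 0], !![0, -Complex.I; Complex.I, 0], !![1, 0; 0, -1]]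

/-- The Pauli string `P_{s 0} ⊗ ⋯ ⊗ P_{s (n-1)}`. -/
def pauliString {n : ℕ} (s : Fin n → Fin 4) : QMatrix n :=
  Matrix.of fun x y => ∏ i, pauli (s i) (x i) (y i)

theorem pauli_star (k : Fin 4) (a b : Fin 2) : star (pauli k b a) = pauli k a b := by
  fin_cases k <;> fin_cases a <;> fin_cases b <;> simp [pauli]

theorem pauliString_isSelfAdjoint {n : ℕ} (s : Fin n → Fin 4) :
    IsSelfAdjoint (pauliString s) := by
  ext x y
  simp only [pauliString, Matrix.star_apply, Matrix.of_apply, star_prod, pauli_star]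

/-- A Pauli string as a Hermitian matrix. -/
def pauliHerm {n : ℕ} (s : Fin n → Fin 4) : Herm n :=
  ⟨pauliString s, pauliString_isSelfAdjoint s⟩

theorem pauli_complete (a b c d : Fin 2) :
    ∑ k, pauli k a b * pauli k c d = if a = d ∧ b = c then 2 else 0 := by
  fin_cases a <;> fin_cases b <;> fin_cases c <;> fin_cases d <;>
    simp [Fin.sum_univ_succ, pauli] <;> norm_num

theorem pauliString_complete {n : ℕ} (x y z w : Fin n → Fin 2) :
    ∑ s : Fin n → Fin 4, pauliString s x y * pauliString s z w =
      if x = w ∧ y = z then (2 : ℂ) ^ n else 0 := by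
  simp only [pauliString, Matrix.of_apply, ← Finset.prod_mul_distrib]
  have hp := Finset.prod_univ_sum (fun _ : Fin n => (Finset.univ : Finset (Fin 4)))
    (fun i k => pauli k (x i) (y i) * pauli k (z i) (w i))
  rw [Fintype.piFinset_univ] at hp
  rw [← hp]
  simp only [pauli_complete]
  split_ifs with h
  · obtain ⟨rfl, rfl⟩ := h
    simp
  · have : ∃ i, ¬ (x i = w i ∧ y i = z i) := by
      by_contra! hc
      exact h ⟨funext fun i => (hc i).1, funext fun i => (hc i).2⟩
    obtain ⟨i, hi⟩ := this
    exact Finset.prod_eq_zero (Finset.mem_univ i) (if_neg hi)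

/-- Expansion of a Hermitian matrix in Pauli strings with real coefficients. -/
theorem herm_eq_sum {n : ℕ} (A : Herm n) :
    A = ∑ s : Fin n → Fin 4,
      (((2 : ℝ) ^ n)⁻¹ * (pauliString s * A.1).trace.re) • pauliHerm s := by
  have hreal : ∀ s : Fin n → Fin 4,
      (((pauliString s * A.1).trace.re : ℝ) : ℂ) = (pauliString s * A.1).trace := by
    intro s
    apply Complex.conj_eq_iff_re.mp
    have h1 := Matrix.trace_conjTranspose (pauliString s * A.1)
    rw [Matrix.conjTranspose_mul, ← Matrix.star_eq_conjTranspose, ← Matrix.star_eq_conjTranspose,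
      (pauliString_isSelfAdjoint s).star_eq, (show star A.1 = A.1 from A.2),
      Matrix.trace_mul_comm] at h1
    exact h1.symm
  apply Subtype.ext
  ext x y
  have key : ∑ s : Fin n → Fin 4, (pauliString s * A.1).trace * pauliString s x y =
      (2 : ℂ) ^ n * A.1 x y := by
    simp only [Matrix.trace, Matrix.diag, Matrix.mul_apply, Finset.sum_mul]
    rw [Finset.sum_comm]
    have : ∀ u : Fin n → Fin 2, ∑ s : Fin n → Fin 4, ∑ v, pauliString s u v * A.1 v u *
        pauliString s x y = ∑ v, (if u = y ∧ v = x then (2 : ℂ) ^ n else 0) * A.1 v u := by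
      intro u
      rw [Finset.sum_comm]
      refine Finset.sum_congr rfl fun v _ => ?_
      rw [← pauliString_complete, Finset.sum_mul]
      exact Finset.sum_congr rfl fun s _ => by ring
    simp only [this, ite_and, ite_mul, zero_mul]
    simp
  have h2 : ((2 : ℂ) ^ n) ≠ 0 := pow_ne_zero _ two_ne_zero
  rw [AddSubgroup.val_finsetSum, Matrix.sum_apply]
  have : ∀ s : Fin n → Fin 4,
      (((((2 : ℝ) ^ n)⁻¹ * (pauliString s * A.1).trace.re) • pauliHerm s : Herm n) : QMatrix n) x y
        = ((2 : ℂ) ^ n)⁻¹ * ((pauliString s * A.1).trace * pauliString s x y) := by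
    intro s
    rw [selfAdjoint.val_smul, Matrix.smul_apply, Complex.real_smul, Complex.ofReal_mul, hreal]
    simp [pauliHerm, mul_assoc]
  simp only [this]
  rw [← Finset.mul_sum, key, inv_mul_cancel_left₀ h2]

instance (n : ℕ) : FiniteDimensional ℝ (Herm n) :=
  Module.Finite.of_surjective
    (∑ s : Fin n → Fin 4, (LinearMap.proj s : ((Fin n → Fin 4) → ℝ) →ₗ[ℝ] ℝ).smulRight
      (pauliHerm s)) fun A =>
    ⟨fun s => ((2 : ℝ) ^ n)⁻¹ * (pauliString s * A.1).trace.re, by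
      simpa using (herm_eq_sum A).symm⟩

/-! ### Superoperators with the superoperator inner product -/

/-- Superoperators: real-linear maps on the space of Hermitian matrices. -/
abbrev Superop (n : ℕ) : Type := Herm n →ₗ[ℝ] Herm n

/-- `Re tr (A B)`; for Hermitian `A`, `B` the trace is real. -/
def trForm {n : ℕ} (A B : Herm n) : ℝ := (A.1 * B.1).trace.re

theorem trForm_comm {n : ℕ} (A B : Herm n) : trForm A B = trForm B A := by
  unfold trForm
  rw [Matrix.trace_mul_comm]

theorem trForm_add {n : ℕ} (A B C : Herm n) : trForm (A + B) C = trForm A C + trForm B C := by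
  simp [trForm, add_mul]

theorem trForm_smul {n : ℕ} (r : ℝ) (A B : Herm n) : trForm (r • A) B = r * trForm A B := by
  simp [trForm]

theorem trForm_self {n : ℕ} (A : Herm n) : trForm A A = ∑ x, ∑ y, ‖A.1 y x‖ ^ 2 := by
  have h : A.1 * A.1 = star A.1 * A.1 := by rw [(show star A.1 = A.1 from A.2)]
  rw [trForm, h]
  simp only [Matrix.trace, Matrix.diag, Matrix.mul_apply, Matrix.star_apply, Complex.re_sum]
  refine Finset.sum_congr rfl fun x _ => Finset.sum_congr rfl fun y _ => ?_
  rw [← Complex.normSq_eq_norm_sq, Complex.star_def, ← Complex.normSq_eq_conj_mul_self,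
    Complex.ofReal_re]

theorem trForm_self_nonneg {n : ℕ} (A : Herm n) : 0 ≤ trForm A A := by
  rw [trForm_self]; positivity

theorem trForm_self_eq_zero {n : ℕ} {A : Herm n} (h : trForm A A = 0) : A = 0 := by
  rw [trForm_self] at h
  apply Subtype.ext
  ext y x
  rw [Finset.sum_eq_zero_iff_of_nonneg (fun _ _ => by positivity)] at h
  have h1 := h x (Finset.mem_univ _)
  rw [Finset.sum_eq_zero_iff_of_nonneg (fun _ _ => by positivity)] at h1
  simpa using h1 y (Finset.mem_univ _)

/-- The superoperator inner product `⟨D, C⟩ = ∑_P tr (D(P) C(P))`, where `P` ranges over all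
`4^n` Pauli strings. -/
def soInner {n : ℕ} (D C : Superop n) : ℝ :=
  ∑ s : Fin n → Fin 4,
    trForm (D (pauliHerm s)) (C (pauliHerm s))

/-- The superoperator inner product is a (positive definite) real inner product. -/
@[reducible] def soCore (n : ℕ) : InnerProductSpace.Core ℝ (Superop n) where
  inner D C := soInner D C
  conj_inner_symm D C := by
    simp only [soInner, conj_trivial]
    exact Finset.sum_congr rfl fun s _ => trForm_comm _ _
  re_inner_nonneg D := by
    exact Finset.sum_nonneg fun s _ => trForm_self_nonneg (D (pauliHerm s))
  add_left D E C := by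
    simp only [soInner, ← Finset.sum_add_distrib]
    exact Finset.sum_congr rfl fun s _ => trForm_add _ _ _
  smul_left D C r := by
    simp only [soInner, conj_trivial, Finset.mul_sum]
    exact Finset.sum_congr rfl fun s _ => trForm_smul _ _ _
  definite D h := by
    have h' : soInner D D = 0 := h
    rw [soInner, Finset.sum_eq_zero_iff_of_nonneg (fun _ _ => trForm_self_nonneg _)] at h'
    refine LinearMap.ext fun A => ?_
    rw [herm_eq_sum A, map_sum, map_sum]
    refine Finset.sum_congr rfl fun s hs => ?_
    rw [map_smul, map_smul]
    congr 1
    exact trForm_self_eq_zero (h' s hs)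

instance (n : ℕ) : NormedAddCommGroup (Superop n) :=
  (soCore n).toNormedAddCommGroup

instance (n : ℕ) : InnerProductSpace ℝ (Superop n) :=
  InnerProductSpace.ofCore (soCore n).toCore

/-! ### Unitary channels and the twirling map -/

/-- The unitary channel `ω(g) : ρ ↦ g ρ g†`, as a homomorphism in `g ∈ U(2^n)`. -/
def channel (n : ℕ) : U n →* Module.End ℝ (Herm n) where
  toFun g :=
    { toFun := fun A => ⟨g.1 * A.1 * star g.1, IsSelfAdjoint.conjugate A.2 g.1⟩
      map_add' := fun A B => Subtype.ext (by simp [mul_add, add_mul])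
      map_smul' := fun r A => Subtype.ext (by simp) }
  map_one' := LinearMap.ext fun A => Subtype.ext (by simp)
  map_mul' g h := LinearMap.ext fun A => Subtype.ext (by simp [mul_assoc])

/-- For a group `G` represented by channels `ω`, the map `C ↦ ω(g⁻¹) ∘ C ∘ ω(g)` on
superoperators. -/
def twirlAt {n : ℕ} {G : Type*} [Group G] (ω : G →* Module.End ℝ (Herm n)) (g : G) :
    Superop n →L[ℝ] Superop n :=
  LinearMap.toContinuousLinearMap
    { toFun := fun C => ω g⁻¹ ∘ₗ C ∘ₗ ω g
      map_add' := fun C D => by rw [LinearMap.add_comp, LinearMap.comp_add]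
      map_smul' := fun r C => by
        rw [LinearMap.smul_comp, LinearMap.comp_smul, RingHom.id_apply] }

/-- The twirling map `Λ(μ) : C ↦ ∫ ω(g⁻¹) ∘ C ∘ ω(g) dμ(g)`, an operator on the
(finite-dimensional, Euclidean) space of superoperators. Its norm `‖Λ(μ)‖` is the operator norm
for the norm induced by the superoperator inner product, i.e. the spectral norm. -/
def twirl {n : ℕ} {G : Type*} [Group G] [MeasurableSpace G] (ω : G →* Module.End ℝ (Herm n))
    (μ : Measure G) : Superop n →L[ℝ] Superop n :=
  ∫ g, twirlAt ω g ∂μ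

/-! ### The Clifford group -/

/-- The Pauli group, generated by the Pauli strings up to phases `i^k`. -/
def pauliGroup (n : ℕ) : Subgroup (U n) :=
  Subgroup.closure
    {g | ∃ (k : ℕ) (s : Fin n → Fin 4), (g : QMatrix n) = Complex.I ^ k • pauliString s}

/-- The unitaries that normalize the Pauli group. -/
def cliffordUnitaries (n : ℕ) : Subgroup (U n) :=
  Subgroup.normalizer (pauliGroup n : Set (U n))

/-- The global phases `z • 1` in `U(2^n)`. -/
def globalPhases (n : ℕ) : Subgroup (U n) where
  carrier := {g | ∃ z : ℂ, (g : QMatrix n) = z • 1}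
  mul_mem' := by
    rintro a b ⟨z, hz⟩ ⟨w, hw⟩
    exact ⟨z * w, by simp [hz, hw, smul_smul, mul_comm]⟩
  one_mem' := ⟨1, by simp⟩
  inv_mem' := by
    rintro a ⟨z, hz⟩
    refine ⟨star z, ?_⟩
    change star (a : QMatrix n) = _
    rw [hz, star_smul, star_one]

instance (n : ℕ) : (globalPhases n).Normal where
  conj_mem := by
    rintro a ⟨z, hz⟩ g
    refine ⟨z, ?_⟩
    change (g : QMatrix n) * a * star (g : QMatrix n) = _
    rw [hz]
    simp

/-- The `n`-qubit Clifford group: the unitaries normalizing the Pauli group, modulo global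
phases. It is a finite group. -/
abbrev CliffordGroup (n : ℕ) : Type :=
  cliffordUnitaries n ⧸ (globalPhases n).subgroupOf (cliffordUnitaries n)

instance (n : ℕ) : MeasurableSpace (CliffordGroup n) := ⊤

theorem channel_of_mem_globalPhases {n : ℕ} {g : U n} (hg : g ∈ globalPhases n) :
    channel n g = 1 := by
  obtain ⟨z, hz⟩ := hg
  have h1 : (g : QMatrix n) * star (g : QMatrix n) = 1 := Matrix.mem_unitaryGroup_iff.mp g.2
  refine LinearMap.ext fun A => Subtype.ext ?_
  change (g : QMatrix n) * A.1 * star (g : QMatrix n) = A.1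
  have h2 : (g : QMatrix n) * A.1 = A.1 * g := by rw [hz]; simp
  rw [h2, mul_assoc, h1, mul_one]

/-- The channel `ω(g)` of an element of the Clifford group; it does not depend on the phase of the
representing unitary. -/
def cliffordChannel (n : ℕ) : CliffordGroup n →* Module.End ℝ (Herm n) :=
  QuotientGroup.lift _ ((channel n).comp (cliffordUnitaries n).subtype) fun _ hg =>
    channel_of_mem_globalPhases (Subgroup.mem_subgroupOf.mp hg)

/-! ### The Haar measure on `SU(2^n)` -/

/-- The channel `ω(g)` for `g ∈ SU(2^n)`. -/
def suChannel (n : ℕ) : SU n →* Module.End ℝ (Herm n) :=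
  (channel n).comp (Submonoid.inclusion Matrix.specialUnitaryGroup_le_unitaryGroup)

instance (n : ℕ) : MeasurableSpace (SU n) := borel _

instance (n : ℕ) : BorelSpace (SU n) := ⟨rfl⟩

instance (n : ℕ) : IsTopologicalGroup (SU n) where
  continuous_inv := Continuous.subtype_mk (continuous_star.comp continuous_subtype_val) _

instance (n : ℕ) : CompactSpace (SU n) := by
  refine isCompact_iff_compactSpace.mp ?_
  have hK : IsCompact (Set.pi Set.univ fun _ : Fin n → Fin 2 =>
      Set.pi Set.univ fun _ : Fin n → Fin 2 => Metric.closedBall (0 : ℂ) 1) :=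
    isCompact_univ_pi fun _ => isCompact_univ_pi fun _ => isCompact_closedBall _ _
  refine IsCompact.of_isClosed_subset (X := QMatrix n) hK ?_ ?_
  · have h1 : IsClosed {A : QMatrix n | A * star A = 1} :=
      isClosed_eq (continuous_id.mul continuous_star) continuous_const
    have h2 : IsClosed {A : QMatrix n | A.det = 1} :=
      isClosed_eq (Continuous.matrix_det continuous_id) continuous_const
    convert h1.inter h2 using 1
    ext A
    simp only [SetLike.mem_coe, Matrix.mem_specialUnitaryGroup_iff, Matrix.mem_unitaryGroup_iff,
      Set.mem_inter_iff, Set.mem_ofPred_eq]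
  · intro A hA i _ j _
    rw [mem_closedBall_zero_iff]
    exact entry_norm_bound_of_unitary (Matrix.mem_specialUnitaryGroup_iff.mp hA).1 i j

/-- The Haar probability measure `μ_H` on `SU(2^n)`. -/
def haarSU (n : ℕ) : Measure (SU n) := Measure.haarMeasure ⊤

end CliffordTwirl

end

open CliffordTwirl

/-! Write `T` for the twirl over `μ` and `P` for the Haar twirl. Each `twirlAt ω g` is an isometry
for the superoperator inner product, so `P` is the orthogonal projection onto the
`SU(2^n)`-invariant superoperators. `T` fixes these, because Clifford channels are also channels of
elements of `SU(2^n)`. Hence `(T - P) v = T (v - P v)` with `‖v - P v‖ ≤ ‖v‖`.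

`T` averages vectors of equal norm, so it preserves the norm of `w = v - P v` only if all `twirlAt g
w` with `g` in the support coincide. The support then lies in one right coset of the stabilizer of
`w`, and strong scrambling makes `w` Clifford-invariant.

The decisive fact is the 2-design property (`commute_channel_of_commute_clifford`): Clifford
invariance implies unitary invariance. Pauli conjugations make an invariant superoperator diagonal
in the Pauli strings. The Clifford unitary `(P_s + P_t)/√2` exchanges anticommuting strings, and any
two nonidentity strings anticommute with a common third, so all eigenvalues off the identity agree.
The superoperator is then a combination of the identity map and `ρ ↦ tr(ρ) 1`. So `P w = w`, while
`P w = 0`, giving `w = 0`. This yields `‖(T - P) v‖ < ‖v‖` for `v ≠ 0`, and compactness of the unit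
ball bounds the norm strictly. -/

namespace CliffordTwirl

/-! ### The algebra of Pauli strings -/

/-- The Kronecker product of `n` single-qubit matrices. -/
def tensor {n : ℕ} (M : Fin n → Matrix (Fin 2) (Fin 2) ℂ) : QMatrix n :=
  Matrix.of fun x y => ∏ i, M i (x i) (y i)

theorem tensor_mul {n : ℕ} (M N : Fin n → Matrix (Fin 2) (Fin 2) ℂ) :
    tensor M * tensor N = tensor fun i => M i * N i := by
  ext x y
  simp only [tensor, Matrix.mul_apply, Matrix.of_apply, ← Finset.prod_mul_distrib]
  have h := Finset.prod_univ_sum (fun _ : Fin n => (Finset.univ : Finset (Fin 2)))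
    (fun i k => M i (x i) k * N i k (y i))
  rw [Fintype.piFinset_univ] at h
  exact h.symm

theorem tensor_smul {n : ℕ} (c : Fin n → ℂ) (M : Fin n → Matrix (Fin 2) (Fin 2) ℂ) :
    tensor (fun i => c i • M i) = (∏ i, c i) • tensor M := by
  ext x y
  simp [tensor, Finset.prod_mul_distrib]

/-- The sign `±1` by which two single-qubit Pauli matrices commute. -/
def pauliSign (a b : Fin 4) : ℤ := if a = 0 ∨ b = 0 ∨ a = b then 1 else -1

/-- With `I, X, Y, Z` labelled `0, 1, 2, 3`, bitwise xor is multiplication modulo phases, and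
commutation signs are characters of this group. -/
theorem pauliSign_xor (a b c : Fin 4) :
    pauliSign (a ^^^ b) c = pauliSign a c * pauliSign b c := by
  revert a b c; decide

theorem exists_pauliSign_ne {b c : Fin 4} (h : b ≠ c) : ∃ a, pauliSign a b ≠ pauliSign a c := by
  revert b c; decide

theorem pauliSign_comm (a b : Fin 4) : pauliSign a b = pauliSign b a := by
  revert a b; decide

theorem pauliSign_eq_or (a b : Fin 4) : pauliSign a b = 1 ∨ pauliSign a b = -1 := by
  revert a b; decide

theorem pauli_mul_comm (a b : Fin 4) :
    pauli a * pauli b = (pauliSign a b : ℂ) • (pauli b * pauli a) := by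
  fin_cases a <;> fin_cases b <;> simp [pauli, pauliSign]

theorem pauli_zero : pauli 0 = 1 := by
  simp [pauli, Matrix.one_fin_two]

theorem pauli_mul_self (a : Fin 4) : pauli a * pauli a = 1 := by
  fin_cases a <;> simp [pauli, Matrix.one_fin_two]

theorem exists_pauli_mul (a b : Fin 4) :
    ∃ k : ℕ, pauli a * pauli b = Complex.I ^ k • pauli (a ^^^ b) := by
  -- The phase is `i` for the cyclic products `XY`, `YZ`, `ZX` and `-i = i ^ 3` for the reversed
  -- ones.
  refine ⟨if a = 0 ∨ b = 0 ∨ a = b then 0 else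
    if a = 1 ∧ b = 2 ∨ a = 2 ∧ b = 3 ∨ a = 3 ∧ b = 1 then 1 else 3, ?_⟩
  have h11 : (1 : Fin 4) ^^^ 1 = 0 := by decide
  have h12 : (1 : Fin 4) ^^^ 2 = 3 := by decide
  have h13 : (1 : Fin 4) ^^^ 3 = 2 := by decide
  have h21 : (2 : Fin 4) ^^^ 1 = 3 := by decide
  have h22 : (2 : Fin 4) ^^^ 2 = 0 := by decide
  have h23 : (2 : Fin 4) ^^^ 3 = 1 := by decide
  have h31 : (3 : Fin 4) ^^^ 1 = 2 := by decide
  have h32 : (3 : Fin 4) ^^^ 2 = 1 := by decide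
  have h33 : (3 : Fin 4) ^^^ 3 = 0 := by decide
  fin_cases a <;> fin_cases b <;> simp [h11, h12, h13, h21, h22, h23, h31, h32, h33] <;>
    simp [pauli]

variable {n : ℕ}

theorem tensor_one : tensor (fun _ : Fin n => 1) = 1 := by
  ext x y
  simp only [tensor, Matrix.of_apply, Matrix.one_apply]
  split_ifs with h
  · simp [h]
  · obtain ⟨i, hi⟩ := Function.ne_iff.mp h
    exact Finset.prod_eq_zero (Finset.mem_univ i) (if_neg hi)

/-- The sign `±1` by which two Pauli strings commute. -/
def stringSign (s t : Fin n → Fin 4) : ℤ := ∏ i, pauliSign (s i) (t i)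

theorem stringSign_comm (s t : Fin n → Fin 4) : stringSign s t = stringSign t s :=
  Finset.prod_congr rfl fun _ _ => pauliSign_comm _ _

theorem stringSign_eq_or (s t : Fin n → Fin 4) : stringSign s t = 1 ∨ stringSign s t = -1 := by
  unfold stringSign
  refine Finset.prod_induction _ (fun z : ℤ => z = 1 ∨ z = -1) ?_ (Or.inl rfl)
    fun _ _ => pauliSign_eq_or _ _
  rintro a b (rfl | rfl) (rfl | rfl) <;> simp

theorem stringSign_xor (r s t : Fin n → Fin 4) :
    stringSign (fun i => r i ^^^ s i) t = stringSign r t * stringSign s t := by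
  simp only [stringSign, pauliSign_xor, Finset.prod_mul_distrib]

/-- A single-site Pauli at a position where the strings differ already separates them. -/
theorem exists_stringSign_ne {s t : Fin n → Fin 4} (h : s ≠ t) :
    ∃ r, stringSign r s ≠ stringSign r t := by
  obtain ⟨i, hi⟩ := Function.ne_iff.mp h
  obtain ⟨a, ha⟩ := exists_pauliSign_ne hi
  have key : ∀ u : Fin n → Fin 4,
      stringSign (Function.update (fun _ => 0) i a) u = pauliSign a (u i) := by
    intro u
    unfold stringSign
    rw [Finset.prod_eq_single i]
    · simp
    · intro j _ hj
      simp [hj, pauliSign]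
    · simp
  exact ⟨Function.update (fun _ => 0) i a, by rwa [key, key]⟩

theorem exists_stringSign_eq_neg_one {s : Fin n → Fin 4} (h : s ≠ 0) :
    ∃ r, stringSign r s = -1 := by
  obtain ⟨r, hr⟩ := exists_stringSign_ne h
  have h0 : stringSign r 0 = 1 := by simp [stringSign, pauliSign]
  rw [h0] at hr
  exact ⟨r, (stringSign_eq_or r s).resolve_left hr⟩

/-- Take `a` anticommuting with `s` and `b` with `t`; if neither serves both, their product does. -/
theorem exists_stringSign_eq_neg_one₂ {s t : Fin n → Fin 4} (hs : s ≠ 0) (ht : t ≠ 0) :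
    ∃ r, stringSign r s = -1 ∧ stringSign r t = -1 := by
  obtain ⟨a, ha⟩ := exists_stringSign_eq_neg_one hs
  obtain ⟨b, hb⟩ := exists_stringSign_eq_neg_one ht
  rcases stringSign_eq_or a t with hat | hat
  · rcases stringSign_eq_or b s with hbs | hbs
    · exact ⟨fun i => a i ^^^ b i, by simp [stringSign_xor, ha, hbs],
        by simp [stringSign_xor, hb, hat]⟩
    · exact ⟨b, hbs, hb⟩
  · exact ⟨a, ha, hat⟩

theorem pauliString_mul_comm (s t : Fin n → Fin 4) :
    pauliString s * pauliString t = (stringSign s t : ℂ) • (pauliString t * pauliString s) := by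
  change tensor (fun i => pauli (s i)) * tensor (fun i => pauli (t i)) =
    _ • (tensor (fun i => pauli (t i)) * tensor (fun i => pauli (s i)))
  rw [tensor_mul, tensor_mul, stringSign, Int.cast_prod, ← tensor_smul]
  exact congrArg tensor (funext fun i => pauli_mul_comm _ _)

theorem pauliString_mul_self (s : Fin n → Fin 4) : pauliString s * pauliString s = 1 := by
  change tensor (fun i => pauli (s i)) * tensor (fun i => pauli (s i)) = 1
  rw [tensor_mul]
  simp only [pauli_mul_self, tensor_one]

theorem pauliString_zero : pauliString (0 : Fin n → Fin 4) = 1 := by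
  change tensor (fun _ => pauli 0) = 1
  simp only [pauli_zero, tensor_one]

theorem exists_pauliString_mul (s t : Fin n → Fin 4) :
    ∃ k : ℕ, pauliString s * pauliString t =
      Complex.I ^ k • pauliString fun i => s i ^^^ t i := by
  choose k hk using fun i => exists_pauli_mul (s i) (t i)
  refine ⟨∑ i, k i, ?_⟩
  change tensor (fun i => pauli (s i)) * tensor (fun i => pauli (t i)) =
    _ • tensor fun i => pauli (s i ^^^ t i)
  rw [tensor_mul, ← Finset.prod_pow_eq_pow_sum, ← tensor_smul]
  exact congrArg tensor (funext hk)

theorem star_pauliString (s : Fin n → Fin 4) : star (pauliString s) = pauliString s :=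
  pauliString_isSelfAdjoint s

theorem pauliHerm_ne_zero (s : Fin n → Fin 4) : pauliHerm s ≠ 0 := by
  intro h
  have h1 : pauliString s = 0 := congrArg Subtype.val h
  have h2 := pauliString_mul_self s
  rw [h1, zero_mul] at h2
  exact zero_ne_one h2

/-- A Pauli string as a unitary. -/
def pauliUnitary (s : Fin n → Fin 4) : U n :=
  ⟨pauliString s, Matrix.mem_unitaryGroup_iff.mpr (by rw [star_pauliString, pauliString_mul_self])⟩

/-! ### The Pauli group and the Clifford group -/

theorem star_I_pow_smul_pauliString (k : ℕ) (s : Fin n → Fin 4) :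
    star (Complex.I ^ k • pauliString s) = Complex.I ^ (3 * k) • pauliString s := by
  rw [star_smul, star_pauliString, pow_mul, Complex.I_pow_three]
  simp

/-- The generating set is already closed under products and inverses. -/
theorem mem_pauliGroup_iff {g : U n} : g ∈ pauliGroup n ↔
    ∃ (k : ℕ) (s : Fin n → Fin 4), (g : QMatrix n) = Complex.I ^ k • pauliString s := by
  refine ⟨fun h => ?_, fun h => Subgroup.subset_closure h⟩
  induction h using Subgroup.closure_induction with
  | mem x hx => exact hx
  | one => exact ⟨0, 0, by simp [pauliString_zero]⟩
  | mul x y _ _ hx hy =>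
    obtain ⟨k, s, hx⟩ := hx
    obtain ⟨l, t, hy⟩ := hy
    obtain ⟨m, hm⟩ := exists_pauliString_mul s t
    refine ⟨k + l + m, fun i => s i ^^^ t i, ?_⟩
    change (x : QMatrix n) * (y : QMatrix n) = _
    rw [hx, hy, smul_mul_smul_comm, hm, smul_smul, ← pow_add, ← pow_add]
  | inv x _ hx =>
    obtain ⟨k, s, hx⟩ := hx
    refine ⟨3 * k, s, ?_⟩
    change star (x : QMatrix n) = _
    rw [hx, star_I_pow_smul_pauliString]

theorem pauliUnitary_mem_pauliGroup (s : Fin n → Fin 4) : pauliUnitary s ∈ pauliGroup n :=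
  mem_pauliGroup_iff.mpr ⟨0, s, by simp [pauliUnitary]⟩

theorem pauliUnitary_mem_cliffordUnitaries (s : Fin n → Fin 4) :
    pauliUnitary s ∈ cliffordUnitaries n :=
  Subgroup.le_normalizer (pauliUnitary_mem_pauliGroup s)

/-- Evaluate `∑ P g P` over all Pauli strings twice: completeness gives `2^n tr(g) 1`, and
commutation gives `4^n g`. -/
theorem mem_globalPhases_of_commute {g : U n}
    (h : ∀ s : Fin n → Fin 4, (g : QMatrix n) * pauliString s = pauliString s * (g : QMatrix n)) :
    g ∈ globalPhases n := by
  have h1 : ∑ s : Fin n → Fin 4, pauliString s * (g : QMatrix n) * pauliString s =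
      (2 : ℂ) ^ n • (g : QMatrix n).trace • 1 := by
    ext x y
    rw [Matrix.sum_apply]
    simp only [Matrix.mul_apply, Finset.sum_mul]
    rw [Finset.sum_comm]
    simp_rw [Finset.sum_comm (s := (Finset.univ : Finset (Fin n → Fin 4)))]
    have : ∀ u v : Fin n → Fin 2, ∑ s : Fin n → Fin 4,
        pauliString s x v * (g : QMatrix n) v u * pauliString s u y =
        (if x = y ∧ v = u then (2 : ℂ) ^ n else 0) * (g : QMatrix n) v u := by
      intro u v
      rw [← pauliString_complete, Finset.sum_mul]
      exact Finset.sum_congr rfl fun s _ => by ring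
    simp only [this]
    by_cases hxy : x = y
    · simp [hxy, Matrix.trace, Finset.mul_sum]
    · simp [hxy]
  have h2 : ∑ s : Fin n → Fin 4, pauliString s * (g : QMatrix n) * pauliString s =
      (4 : ℂ) ^ n • (g : QMatrix n) := by
    simp only [mul_assoc, h]
    simp only [← mul_assoc, pauliString_mul_self, one_mul]
    simp [← Nat.cast_smul_eq_nsmul ℂ]
  refine ⟨((4 : ℂ) ^ n)⁻¹ * ((2 : ℂ) ^ n * (g : QMatrix n).trace), ?_⟩
  rw [← smul_smul, ← smul_smul, ← h1, h2, inv_smul_smul₀ (pow_ne_zero _ (by norm_num))]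

theorem channel_apply_val (g : U n) (A : Herm n) :
    (channel n g A).1 = (g : QMatrix n) * A.1 * star (g : QMatrix n) := rfl

theorem mem_globalPhases_of_channel_eq_one {g : U n} (h : channel n g = 1) :
    g ∈ globalPhases n := by
  refine mem_globalPhases_of_commute fun s => ?_
  have h1 : (g : QMatrix n) * pauliString s * star (g : QMatrix n) = pauliString s :=
    congrArg Subtype.val (LinearMap.congr_fun h (pauliHerm s))
  have h2 : star (g : QMatrix n) * (g : QMatrix n) = 1 := Matrix.mem_unitaryGroup_iff'.mp g.2
  nth_rw 2 [← h1]
  rw [mul_assoc _ _ (g : QMatrix n), h2, mul_one]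

theorem cliffordChannel_injective (n : ℕ) : Function.Injective (cliffordChannel n) := by
  rw [injective_iff_map_eq_one]
  intro q
  induction q using QuotientGroup.induction_on with
  | H g =>
    intro h
    exact (QuotientGroup.eq_one_iff g).mpr
      (Subgroup.mem_subgroupOf.mpr (mem_globalPhases_of_channel_eq_one h))

theorem cliffordChannel_pauliHerm (q : CliffordGroup n) (s : Fin n → Fin 4) :
    ∃ (k : Fin 4) (t : Fin n → Fin 4),
      (cliffordChannel n q (pauliHerm s)).1 = Complex.I ^ (k : ℕ) • pauliString t := by
  induction q using QuotientGroup.induction_on with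
  | H g =>
    obtain ⟨k, t, h⟩ := mem_pauliGroup_iff.mp
      ((Subgroup.mem_normalizer_iff.mp g.2 _).mp (pauliUnitary_mem_pauliGroup s))
    -- Reducing the exponent leaves finitely many possible images, from which finiteness of the
    -- Clifford group follows.
    refine ⟨⟨k % 4, Nat.mod_lt _ (by norm_num)⟩, t, ?_⟩
    rw [← Complex.I_pow_eq_pow_mod]
    exact h

instance (n : ℕ) : Finite (CliffordGroup n) := by
  have hfin : {A : QMatrix n | ∃ (k : Fin 4) (t : Fin n → Fin 4),
      A = Complex.I ^ (k : ℕ) • pauliString t}.Finite := by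
    refine (Set.finite_range fun p : Fin 4 × (Fin n → Fin 4) =>
      Complex.I ^ (p.1 : ℕ) • pauliString p.2).subset ?_
    rintro _ ⟨k, t, rfl⟩
    exact ⟨(k, t), rfl⟩
  have := hfin.to_subtype
  refine Finite.of_injective (fun (q : CliffordGroup n) (s : Fin n → Fin 4) =>
    (⟨_, cliffordChannel_pauliHerm q s⟩ : {A : QMatrix n | ∃ (k : Fin 4) (t : Fin n → Fin 4),
      A = Complex.I ^ (k : ℕ) • pauliString t})) fun p q h => ?_
  refine cliffordChannel_injective n (LinearMap.ext fun A => ?_)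
  rw [herm_eq_sum A, map_sum, map_sum]
  refine Finset.sum_congr rfl fun s _ => ?_
  rw [map_smul, map_smul]
  exact congrArg _ (Subtype.ext (congrArg Subtype.val (congrFun h s) :))

/-! ### Unitary channels and the trace form -/

/-- The trace form as a bilinear form. -/
noncomputable def trBilin (n : ℕ) : Herm n →ₗ[ℝ] Herm n →ₗ[ℝ] ℝ :=
  LinearMap.mk₂ ℝ trForm trForm_add trForm_smul
    (fun A B C => by rw [trForm_comm, trForm_add, trForm_comm B, trForm_comm C])
    (fun r A B => by rw [trForm_comm, trForm_smul, trForm_comm B, smul_eq_mul])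

theorem herm_eq_sum_trForm (A : Herm n) :
    A = ∑ s : Fin n → Fin 4, (((2 : ℝ) ^ n)⁻¹ * trForm (pauliHerm s) A) • pauliHerm s :=
  herm_eq_sum A

theorem trForm_channel (g : U n) (A B : Herm n) :
    trForm (channel n g A) (channel n g B) = trForm A B := by
  have h : star (g : QMatrix n) * (g : QMatrix n) = 1 := Matrix.mem_unitaryGroup_iff'.mp g.2
  have e : (g : QMatrix n) * A.1 * star (g : QMatrix n) *
      ((g : QMatrix n) * B.1 * star (g : QMatrix n)) =
      (g : QMatrix n) * (A.1 * B.1) * star (g : QMatrix n) := by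
    calc _ = (g : QMatrix n) * A.1 * (star (g : QMatrix n) * (g : QMatrix n)) * B.1 *
        star (g : QMatrix n) := by simp only [mul_assoc]
      _ = _ := by rw [h, mul_one]; simp only [mul_assoc]
  unfold trForm
  rw [channel_apply_val, channel_apply_val, e, Matrix.trace_mul_comm, ← mul_assoc, h, one_mul]

theorem channel_inv_apply (g : U n) (A : Herm n) : channel n g⁻¹ (channel n g A) = A := by
  rw [← Module.End.mul_apply, ← map_mul, inv_mul_cancel, map_one, Module.End.one_apply]

theorem channel_apply_inv (g : U n) (A : Herm n) : channel n g (channel n g⁻¹ A) = A := by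
  rw [← Module.End.mul_apply, ← map_mul, mul_inv_cancel, map_one, Module.End.one_apply]

theorem trForm_channel_right (g : U n) (A B : Herm n) :
    trForm A (channel n g B) = trForm B (channel n g⁻¹ A) := by
  rw [trForm_comm, ← trForm_channel g⁻¹, channel_inv_apply]

/-- The trace of a bilinear form does not depend on the orthogonal basis: expand one argument in
Pauli strings, move the channel across the trace form, and resum. It makes precomposition with a
channel an isometry. -/
theorem sum_bilin_channel_pauliHerm (B : Herm n →ₗ[ℝ] Herm n →ₗ[ℝ] ℝ) (g : U n) :
    ∑ s : Fin n → Fin 4, B (channel n g (pauliHerm s)) (channel n g (pauliHerm s)) =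
      ∑ s : Fin n → Fin 4, B (pauliHerm s) (pauliHerm s) := by
  have h1 : ∀ s : Fin n → Fin 4,
      B (channel n g (pauliHerm s)) (channel n g (pauliHerm s)) =
      ∑ t : Fin n → Fin 4, B (pauliHerm t) (channel n g
        ((((2 : ℝ) ^ n)⁻¹ * trForm (pauliHerm s) (channel n g⁻¹ (pauliHerm t))) •
          pauliHerm s)) := by
    intro s
    conv_lhs => enter [1]; rw [herm_eq_sum_trForm (channel n g (pauliHerm s))]
    rw [map_sum, LinearMap.sum_apply]
    refine Finset.sum_congr rfl fun t _ => ?_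
    rw [map_smul, LinearMap.smul_apply, map_smul, map_smul, trForm_channel_right]
  simp only [h1]
  rw [Finset.sum_comm]
  refine Finset.sum_congr rfl fun t _ => ?_
  rw [← map_sum, ← map_sum, ← herm_eq_sum_trForm, channel_apply_inv]

theorem soInner_channel_comp (g : U n) (D C : Superop n) :
    soInner (channel n g ∘ₗ D) (channel n g ∘ₗ C) = soInner D C := by
  unfold soInner
  exact Finset.sum_congr rfl fun s _ => trForm_channel g (D (pauliHerm s)) (C (pauliHerm s))

theorem soInner_comp_channel (g : U n) (D C : Superop n) :
    soInner (D ∘ₗ channel n g) (C ∘ₗ channel n g) = soInner D C :=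
  sum_bilin_channel_pauliHerm ((trBilin n).compl₁₂ D C) g

/-! ### Isometric action on superoperators and its stabilizers -/

section TwirlAt

variable {G : Type*} [Group G] {ω : G →* Module.End ℝ (Herm n)}

theorem twirlAt_apply (g : G) (C : Superop n) : twirlAt ω g C = ω g⁻¹ ∘ₗ C ∘ₗ ω g := rfl

theorem twirlAt_one (C : Superop n) : twirlAt ω 1 C = C := by
  rw [twirlAt_apply, inv_one, map_one]
  rfl

/-- The order reverses, so this is a right action; hence right cosets and right invariance of Haar
measure are what matter later. -/
theorem twirlAt_mul (g h : G) (C : Superop n) :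
    twirlAt ω (g * h) C = twirlAt ω h (twirlAt ω g C) := by
  simp only [twirlAt_apply, mul_inv_rev, map_mul]
  rfl

theorem inner_twirlAt (hω : ∀ g, ∃ u : U n, ω g = channel n u) (g : G) (D C : Superop n) :
    inner ℝ (twirlAt ω g D) (twirlAt ω g C) = inner ℝ D C := by
  change soInner (ω g⁻¹ ∘ₗ D ∘ₗ ω g) (ω g⁻¹ ∘ₗ C ∘ₗ ω g) = soInner D C
  obtain ⟨u, hu⟩ := hω g
  obtain ⟨v, hv⟩ := hω g⁻¹
  rw [hu, hv, soInner_channel_comp, soInner_comp_channel]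

theorem norm_twirlAt (hω : ∀ g, ∃ u : U n, ω g = channel n u) (g : G) (D : Superop n) :
    ‖twirlAt ω g D‖ = ‖D‖ := by
  rw [@norm_eq_sqrt_real_inner, @norm_eq_sqrt_real_inner, inner_twirlAt hω]

/-- The elements of the group whose twirl fixes `D`. -/
def twirlStabilizer (ω : G →* Module.End ℝ (Herm n)) (D : Superop n) : Subgroup G where
  carrier := {g | twirlAt ω g D = D}
  one_mem' := twirlAt_one D
  mul_mem' := fun {a b} ha hb => by
    rw [Set.mem_ofPred_eq] at *
    rw [twirlAt_mul, ha, hb]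
  inv_mem' := fun {a} ha => by
    rw [Set.mem_ofPred_eq] at *
    nth_rw 1 [← ha]
    rw [← twirlAt_mul, mul_inv_cancel, twirlAt_one]

theorem mem_twirlStabilizer {g : G} {D : Superop n} :
    g ∈ twirlStabilizer ω D ↔ twirlAt ω g D = D := Iff.rfl

theorem mem_twirlStabilizer_iff_commute {g : G} {D : Superop n} :
    g ∈ twirlStabilizer ω D ↔ ∀ A, D (ω g A) = ω g (D A) := by
  rw [mem_twirlStabilizer, twirlAt_apply]
  constructor
  · intro h A
    nth_rw 2 [← h]
    change D (ω g A) = (ω g * ω g⁻¹) (D (ω g A))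
    rw [← map_mul, mul_inv_cancel, map_one, Module.End.one_apply]
  · intro h
    refine LinearMap.ext fun A => ?_
    change ω g⁻¹ (D (ω g A)) = D A
    rw [h]
    change (ω g⁻¹ * ω g) (D A) = D A
    rw [← map_mul, inv_mul_cancel, map_one, Module.End.one_apply]

end TwirlAt

/-! ### Clifford-invariant superoperators -/

theorem channel_pauliUnitary (r s : Fin n → Fin 4) :
    channel n (pauliUnitary r) (pauliHerm s) = (stringSign r s : ℝ) • pauliHerm s := by
  apply Subtype.ext
  rw [channel_apply_val, selfAdjoint.val_smul]
  change pauliString r * pauliString s * star (pauliString r) = (stringSign r s : ℝ) • pauliString s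
  rw [star_pauliString, pauliString_mul_comm, smul_mul_assoc, mul_assoc, pauliString_mul_self,
    mul_one]
  ext x y
  simp

/-- A superoperator commuting with the channels of all Clifford unitaries is diagonal in the Pauli
strings. -/
theorem exists_smul_pauliHerm {D : Superop n}
    (hD : ∀ g ∈ cliffordUnitaries n, ∀ A, D (channel n g A) = channel n g (D A))
    (s : Fin n → Fin 4) : ∃ c : ℝ, D (pauliHerm s) = c • pauliHerm s := by
  have h0 : ∀ t, t ≠ s → trForm (pauliHerm t) (D (pauliHerm s)) = 0 := by
    intro t hts
    -- Conjugation by `P_r` preserves the trace form but multiplies its two arguments by opposite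
    -- signs, so the coefficient equals its own negative.
    obtain ⟨r, hr⟩ := exists_stringSign_ne hts
    have h1 := trForm_channel (pauliUnitary r) (pauliHerm t) (D (pauliHerm s))
    rw [← hD _ (pauliUnitary_mem_cliffordUnitaries r), channel_pauliUnitary,
      channel_pauliUnitary, map_smul, trForm_smul, trForm_comm, trForm_smul, trForm_comm] at h1
    rcases stringSign_eq_or r t with h2 | h2 <;> rcases stringSign_eq_or r s with h3 | h3 <;>
      first
      | exact absurd (h2.trans h3.symm) hr
      | rw [h2, h3] at h1
        push_cast at h1
        linarith
  refine ⟨((2 : ℝ) ^ n)⁻¹ * trForm (pauliHerm s) (D (pauliHerm s)), ?_⟩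
  conv_lhs => rw [herm_eq_sum_trForm (D (pauliHerm s))]
  rw [Finset.sum_eq_single s]
  · intro t _ hts
    rw [h0 t hts, mul_zero, zero_smul]
  · simp

/-! ### Clifford unitaries exchanging anticommuting Pauli strings -/

section Swap

variable {s t : Fin n → Fin 4}

theorem pauliString_anticomm (h : stringSign s t = -1) :
    pauliString t * pauliString s = -(pauliString s * pauliString t) := by
  have := pauliString_mul_comm t s
  rw [stringSign_comm, h] at this
  simpa using this

/-- The matrix `(P_s + P_t) / √2`. -/
noncomputable def swapMatrix (s t : Fin n → Fin 4) : QMatrix n :=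
  (((Real.sqrt 2)⁻¹ : ℝ) : ℂ) • (pauliString s + pauliString t)

theorem star_swapMatrix (s t : Fin n → Fin 4) : star (swapMatrix s t) = swapMatrix s t := by
  rw [swapMatrix, star_smul, star_add, star_pauliString, star_pauliString]
  simp

theorem swapMatrix_mul_mul (s t : Fin n → Fin 4) (A : QMatrix n) :
    swapMatrix s t * A * swapMatrix s t = (2 : ℂ)⁻¹ •
      ((pauliString s + pauliString t) * A * (pauliString s + pauliString t)) := by
  have h : (((Real.sqrt 2)⁻¹ : ℝ) : ℂ) * (((Real.sqrt 2)⁻¹ : ℝ) : ℂ) = 2⁻¹ := by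
    rw [← Complex.ofReal_mul, ← mul_inv, Real.mul_self_sqrt (by norm_num)]
    simp
  rw [swapMatrix, smul_mul_assoc, smul_mul_smul_comm, h]

theorem swapMatrix_mul_self (h : stringSign s t = -1) :
    swapMatrix s t * swapMatrix s t = 1 := by
  have h1 := swapMatrix_mul_mul s t 1
  rw [mul_one, mul_one, add_mul, mul_add, mul_add, pauliString_mul_self, pauliString_mul_self,
    pauliString_anticomm h] at h1
  rw [h1, show (1 : QMatrix n) + pauliString s * pauliString t +
    (-(pauliString s * pauliString t) + 1) = (2 : ℂ) • 1 by rw [two_smul]; abel,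
    inv_smul_smul₀ two_ne_zero]

/-- The unitary `(P_s + P_t) / √2` for anticommuting `P_s`, `P_t`. -/
noncomputable def swapUnitary (h : stringSign s t = -1) : U n :=
  ⟨swapMatrix s t, Matrix.mem_unitaryGroup_iff.mpr (by
    rw [star_swapMatrix, swapMatrix_mul_self h])⟩

theorem swapMatrix_conj (h : stringSign s t = -1) :
    swapMatrix s t * pauliString s * swapMatrix s t = pauliString t := by
  have hts := pauliString_anticomm h
  have hs := pauliString_mul_self s
  have ht := pauliString_mul_self t
  rw [swapMatrix_mul_mul, inv_smul_eq_iff₀ two_ne_zero, add_mul, hs, hts]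
  calc (1 + -(pauliString s * pauliString t)) * (pauliString s + pauliString t) =
      pauliString s + pauliString t - pauliString s * (pauliString t * pauliString s) -
        pauliString s * (pauliString t * pauliString t) := by noncomm_ring
    _ = pauliString s + pauliString t + pauliString s * pauliString s * pauliString t -
        pauliString s * (pauliString t * pauliString t) := by rw [hts]; noncomm_ring
    _ = _ := by rw [hs, ht, two_smul]; noncomm_ring

theorem swapMatrix_conj_pauliString (h : stringSign s t = -1) (r : Fin n → Fin 4) :
    ∃ (k : ℕ) (u : Fin n → Fin 4),
      swapMatrix s t * pauliString r * swapMatrix s t = Complex.I ^ k • pauliString u := by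
  have hts := pauliString_anticomm h
  have hs := pauliString_mul_self s
  have ht := pauliString_mul_self t
  -- With signs `a, b = ±1`, equal signs give `± P_r` and opposite signs give `± P_r P_s P_t`; both
  -- are Pauli strings up to phase.
  have hP : ∀ a b : ℂ, pauliString s * pauliString r = a • (pauliString r * pauliString s) →
      pauliString t * pauliString r = b • (pauliString r * pauliString t) →
      swapMatrix s t * pauliString r * swapMatrix s t = (2 : ℂ)⁻¹ • (pauliString r *
        ((a + b) • 1 + (a - b) • (pauliString s * pauliString t))) := by
    intro a b ha hb
    rw [swapMatrix_mul_mul, add_mul, ha, hb, add_mul, mul_add, mul_add, smul_mul_assoc,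
      smul_mul_assoc, smul_mul_assoc, smul_mul_assoc, mul_assoc, mul_assoc, mul_assoc, mul_assoc,
      hs, ht, hts, mul_add, mul_smul_comm, mul_smul_comm, mul_neg, smul_neg, mul_one]
    module
  have h1 := pauliString_mul_comm s r
  have h2 := pauliString_mul_comm t r
  have hmul : ∀ (e : ℕ), ∃ (k : ℕ) (u : Fin n → Fin 4),
      Complex.I ^ e • (pauliString r * (pauliString s * pauliString t)) =
        Complex.I ^ k • pauliString u := by
    intro e
    obtain ⟨k, hk⟩ := exists_pauliString_mul s t
    obtain ⟨l, hl⟩ := exists_pauliString_mul r fun i => s i ^^^ t i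
    exact ⟨e + (k + l), fun i => r i ^^^ (s i ^^^ t i), by
      rw [hk, mul_smul_comm, hl, smul_smul, smul_smul, ← pow_add, ← pow_add, add_assoc]⟩
  have h := hP _ _ h1 h2
  rcases stringSign_eq_or s r with h3 | h3 <;> rcases stringSign_eq_or t r with h4 | h4 <;>
    rw [h3, h4] at h
  · refine ⟨0, r, h.trans ?_⟩
    norm_num [smul_smul]
  · obtain ⟨k, u, hk⟩ := hmul 0
    refine ⟨k, u, (h.trans ?_).trans hk⟩
    norm_num [smul_smul]
  · obtain ⟨k, u, hk⟩ := hmul 2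
    refine ⟨k, u, (h.trans ?_).trans hk⟩
    norm_num [smul_smul]
  · refine ⟨2, r, h.trans ?_⟩
    norm_num [smul_smul]

theorem swapUnitary_mem_cliffordUnitaries (h : stringSign s t = -1) :
    swapUnitary h ∈ cliffordUnitaries n := by
  have hinv : (swapUnitary h)⁻¹ = swapUnitary h := Subtype.ext (star_swapMatrix s t)
  have key : ∀ p ∈ pauliGroup n, swapUnitary h * p * (swapUnitary h)⁻¹ ∈ pauliGroup n := by
    intro p hp
    obtain ⟨k, r, hr⟩ := mem_pauliGroup_iff.mp hp
    obtain ⟨l, u, hl⟩ := swapMatrix_conj_pauliString h r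
    refine mem_pauliGroup_iff.mpr ⟨k + l, u, ?_⟩
    rw [hinv]
    change swapMatrix s t * (p : QMatrix n) * swapMatrix s t = _
    rw [hr, mul_smul_comm, smul_mul_assoc, hl, smul_smul, pow_add]
  refine Subgroup.mem_normalizer_iff.mpr fun p => ⟨key p, fun hp => ?_⟩
  have := key _ hp
  -- The swap unitary is an involution, so conjugating twice gives the reverse inclusion.
  have e : swapUnitary h * (swapUnitary h * p * (swapUnitary h)⁻¹) * (swapUnitary h)⁻¹ = p := by
    have hsq : swapUnitary h * swapUnitary h = 1 := Subtype.ext (swapMatrix_mul_self h)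
    rw [hinv]
    calc _ = swapUnitary h * swapUnitary h * p * (swapUnitary h * swapUnitary h) := by
          simp only [mul_assoc]
      _ = p := by rw [hsq, one_mul, mul_one]
  rwa [e] at this

theorem channel_swapUnitary (h : stringSign s t = -1) :
    channel n (swapUnitary h) (pauliHerm s) = pauliHerm t := by
  apply Subtype.ext
  change swapMatrix s t * pauliString s * star (swapMatrix s t) = pauliString t
  rw [star_swapMatrix, swapMatrix_conj h]

end Swap

/-- Clifford-invariant superoperators are invariant under all unitary channels. -/
theorem commute_channel_of_commute_clifford {D : Superop n}
    (hD : ∀ g ∈ cliffordUnitaries n, ∀ A, D (channel n g A) = channel n g (D A))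
    (g : U n) (A : Herm n) : D (channel n g A) = channel n g (D A) := by
  choose c hc using exists_smul_pauliHerm hD
  have hswap : ∀ s t : Fin n → Fin 4, stringSign s t = -1 → c s = c t := by
    intro s t h
    have h1 := hD _ (swapUnitary_mem_cliffordUnitaries h) (pauliHerm s)
    rw [channel_swapUnitary, hc, hc, map_smul, channel_swapUnitary] at h1
    exact (smul_left_injective ℝ (pauliHerm_ne_zero t) h1).symm
  obtain ⟨b, hb⟩ : ∃ b : ℝ, ∀ s : Fin n → Fin 4, s ≠ 0 → c s = b := by
    by_cases hex : ∃ t : Fin n → Fin 4, t ≠ 0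
    · obtain ⟨t, ht⟩ := hex
      refine ⟨c t, fun s hs => ?_⟩
      obtain ⟨r, hr1, hr2⟩ := exists_stringSign_eq_neg_one₂ hs ht
      rw [← hswap r s hr1, hswap r t hr2]
    · push Not at hex
      -- Only the identity string exists here (`n = 0`), so the value is arbitrary.
      exact ⟨0, fun s hs => absurd (hex s) hs⟩
  -- String `0` is the identity matrix, so the correction is a multiple of `tr(B) 1`; both terms are
  -- visibly unitarily covariant.
  have hform : ∀ B : Herm n, D B = b • B +
      ((c 0 - b) * (((2 : ℝ) ^ n)⁻¹ * trForm (pauliHerm 0) B)) • pauliHerm 0 := by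
    intro B
    conv_lhs => rw [herm_eq_sum_trForm B]
    conv_rhs => enter [1, 2]; rw [herm_eq_sum_trForm B]
    rw [map_sum, Finset.smul_sum, ← Finset.add_sum_erase _ _ (Finset.mem_univ 0),
      ← Finset.add_sum_erase (Finset.univ : Finset (Fin n → Fin 4))
        (fun s => b • (((2 : ℝ) ^ n)⁻¹ * trForm (pauliHerm s) B) • pauliHerm s)
        (Finset.mem_univ 0)]
    have : ∀ s ∈ Finset.univ.erase (0 : Fin n → Fin 4),
        D ((((2 : ℝ) ^ n)⁻¹ * trForm (pauliHerm s) B) • pauliHerm s) =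
        b • (((2 : ℝ) ^ n)⁻¹ * trForm (pauliHerm s) B) • pauliHerm s := by
      intro s hs
      rw [map_smul, hc, hb s (Finset.ne_of_mem_erase hs), smul_comm]
    rw [Finset.sum_congr rfl this, map_smul, hc]
    module
  have hone : channel n g (pauliHerm 0) = pauliHerm 0 := by
    apply Subtype.ext
    change (g : QMatrix n) * pauliString 0 * star (g : QMatrix n) = pauliString 0
    rw [pauliString_zero, mul_one]
    exact Matrix.mem_unitaryGroup_iff.mp g.2
  have htr : trForm (pauliHerm 0) (channel n g A) = trForm (pauliHerm 0) A := by
    conv_lhs => rw [← hone]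
    exact trForm_channel g _ _
  rw [hform, hform, htr, map_add, map_smul, map_smul, hone]

/-! ### Twirling over `SU(2^n)` -/

theorem suChannel_eq_channel (g : SU n) : ∃ u : U n, suChannel n g = channel n u :=
  ⟨_, rfl⟩

theorem cliffordChannel_eq_channel (q : CliffordGroup n) :
    ∃ u : U n, cliffordChannel n q = channel n u := by
  induction q using QuotientGroup.induction_on with
  | H g => exact ⟨g, rfl⟩

/-- Rescale `u` by a `2^n`-th root of `det(u)⁻¹`; this is a phase, which the channel does not see.
-/
theorem exists_suChannel_eq_channel (u : U n) : ∃ g : SU n, suChannel n g = channel n u := by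
  have hdet : ‖(u : QMatrix n).det‖ = 1 :=
    CStarRing.norm_of_mem_unitary (Matrix.det_of_mem_unitary u.2)
  obtain ⟨z, hz⟩ := IsAlgClosed.exists_pow_nat_eq ((u : QMatrix n).det)⁻¹
    (Fintype.card_pos (α := Fin n → Fin 2))
  have hz1 : ‖z‖ = 1 := by
    have h := congrArg norm hz
    rw [norm_pow, norm_inv, hdet, inv_one] at h
    exact (pow_eq_one_iff_of_nonneg (norm_nonneg z) Fintype.card_ne_zero).mp h
  have hzz : z * star z = 1 := by
    rw [Complex.star_def, Complex.mul_conj, Complex.normSq_eq_norm_sq, hz1]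
    simp
  have huu : (u : QMatrix n) * star (u : QMatrix n) = 1 := Matrix.mem_unitaryGroup_iff.mp u.2
  refine ⟨⟨z • (u : QMatrix n), Matrix.mem_specialUnitaryGroup_iff.mpr ⟨?_, ?_⟩⟩, ?_⟩
  · rw [Matrix.mem_unitaryGroup_iff, star_smul, smul_mul_smul_comm, hzz, huu, one_smul]
  · rw [Matrix.det_smul, hz, inv_mul_cancel₀]
    rw [← norm_ne_zero_iff, hdet]
    exact one_ne_zero
  · refine LinearMap.ext fun A => Subtype.ext ?_
    change z • (u : QMatrix n) * A.1 * star (z • (u : QMatrix n)) =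
      (u : QMatrix n) * A.1 * star (u : QMatrix n)
    rw [star_smul, smul_mul_assoc, smul_mul_smul_comm, hzz, one_smul]

/-- A superoperator is Clifford-invariant if and only if it is invariant under `SU(2^n)`. -/
theorem twirlStabilizer_clifford_eq_top_iff {D : Superop n} :
    twirlStabilizer (cliffordChannel n) D = ⊤ ↔ twirlStabilizer (suChannel n) D = ⊤ := by
  simp only [Subgroup.eq_top_iff', mem_twirlStabilizer_iff_commute]
  constructor
  · intro h g A
    obtain ⟨u, hu⟩ := suChannel_eq_channel g
    rw [hu]
    exact commute_channel_of_commute_clifford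
      (fun g hg => h (QuotientGroup.mk (⟨g, hg⟩ : cliffordUnitaries n))) u A
  · intro h q A
    obtain ⟨u, hu⟩ := cliffordChannel_eq_channel q
    obtain ⟨g, hg⟩ := exists_suChannel_eq_channel u
    rw [hu, ← hg]
    exact h g A

theorem continuous_suChannel_apply {X : Type*} [TopologicalSpace X] {f : X → SU n}
    {A : X → Herm n} (hf : Continuous f) (hA : Continuous A) :
    Continuous fun x => suChannel n (f x) (A x) := by
  have h1 : Continuous fun x => (f x : QMatrix n) := continuous_subtype_val.comp hf
  have h2 : Continuous fun x => (A x : QMatrix n) := continuous_subtype_val.comp hA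
  exact Continuous.subtype_mk ((h1.mul h2).mul (continuous_star.comp h1)) _

instance (n : ℕ) : ContinuousSMul ℝ (Herm n) where
  continuous_smul := by
    have h : Continuous fun p : ℝ × Herm n => p.1 • (p.2 : QMatrix n) :=
      continuous_fst.smul (continuous_subtype_val.comp continuous_snd)
    exact Continuous.subtype_mk h _

/-- Evaluation on Pauli strings is an injective linear map from a finite-dimensional space, hence a
closed embedding, so continuity can be checked string by string. -/
theorem continuous_twirlAt_suChannel (C : Superop n) :
    Continuous fun g : SU n => twirlAt (suChannel n) g C := by
  let L : Superop n →ₗ[ℝ] ((Fin n → Fin 4) → Herm n) :=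
    LinearMap.pi fun s => LinearMap.applyₗ (pauliHerm s)
  have hL : LinearMap.ker L = ⊥ := by
    refine LinearMap.ker_eq_bot'.mpr fun D hD => LinearMap.ext fun A => ?_
    rw [herm_eq_sum A, map_sum, map_sum]
    refine Finset.sum_congr rfl fun s _ => ?_
    rw [map_smul, map_smul]
    exact congrArg _ (congrFun hD s)
  have hemb := LinearMap.isClosedEmbedding_of_injective (𝕜 := ℝ) (f := L) hL
  refine hemb.isInducing.continuous_iff.mpr ?_
  refine continuous_pi fun s => ?_
  have hC : Continuous C := C.continuous_of_finiteDimensional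
  have h1 : Continuous fun g : SU n => C (suChannel n g (pauliHerm s)) :=
    hC.comp (continuous_suChannel_apply continuous_id continuous_const)
  exact continuous_suChannel_apply continuous_inv h1

/-! ### The Haar twirl as orthogonal projection onto the invariants -/

instance (n : ℕ) : (haarSU n).IsHaarMeasure := Measure.isHaarMeasure_haarMeasure ⊤

instance (n : ℕ) : IsProbabilityMeasure (haarSU n) :=
  ⟨Measure.haarMeasure_self (K₀ := (⊤ : TopologicalSpace.PositiveCompacts (SU n)))⟩

/-- A right translate of Haar measure is again a Haar probability measure, so uniqueness applies. -/
instance (n : ℕ) : (haarSU n).IsMulRightInvariant where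
  map_mul_right_eq_self g := by
    have : IsProbabilityMeasure ((haarSU n).map (· * g)) :=
      Measure.isProbabilityMeasure_map (measurable_mul_const g).aemeasurable
    exact Measure.isHaarMeasure_eq_of_isProbabilityMeasure _ _

theorem integrable_twirlAt_suChannel (C : Superop n) :
    Integrable (fun g => twirlAt (suChannel n) g C) (haarSU n) :=
  (continuous_twirlAt_suChannel C).integrable_of_hasCompactSupport
    (HasCompactSupport.of_compactSpace _)

theorem integral_clm_apply_of_continuous {X E F : Type*} [TopologicalSpace X] [CompactSpace X]
    [MeasurableSpace X] [BorelSpace X] (μ : Measure X) [IsFiniteMeasure μ]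
    [NormedAddCommGroup E] [NormedSpace ℝ E] [FiniteDimensional ℝ E]
    [NormedAddCommGroup F] [NormedSpace ℝ F] [CompleteSpace F]
    {f : X → E →L[ℝ] F} (hf : ∀ v, Continuous fun x => f x v) (v : E) :
    (∫ x, f x ∂μ) v = ∫ x, f x v ∂μ :=
  ContinuousLinearMap.integral_apply ((continuous_clm_apply.mpr hf).integrable_of_hasCompactSupport
    (HasCompactSupport.of_compactSpace _)) v

theorem twirl_haarSU_apply (C : Superop n) :
    twirl (suChannel n) (haarSU n) C = ∫ g, twirlAt (suChannel n) g C ∂haarSU n :=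
  integral_clm_apply_of_continuous (haarSU n) continuous_twirlAt_suChannel C

theorem twirlStabilizer_twirl_haarSU (C : Superop n) :
    twirlStabilizer (suChannel n) (twirl (suChannel n) (haarSU n) C) = ⊤ := by
  refine (Subgroup.eq_top_iff' _).mpr fun h => ?_
  rw [mem_twirlStabilizer, twirl_haarSU_apply,
    ← ContinuousLinearMap.integral_comp_comm _ (integrable_twirlAt_suChannel C)]
  simp only [← twirlAt_mul]
  exact integral_mul_right_eq_self (fun g => twirlAt (suChannel n) g C) h

/-- Each twirl is an isometry fixing `D`, so the integrand is constant. This supplies the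
orthogonality of the projection. -/
theorem inner_twirl_haarSU {D : Superop n} (hD : twirlStabilizer (suChannel n) D = ⊤)
    (C : Superop n) : inner ℝ D (twirl (suChannel n) (haarSU n) C) = inner ℝ D C := by
  rw [twirl_haarSU_apply,
    ← integral_inner (integrable_twirlAt_suChannel C)]
  have : ∀ g, inner ℝ D (twirlAt (suChannel n) g C) = inner ℝ D C := by
    intro g
    rw [← inner_twirlAt suChannel_eq_channel g D C,
      mem_twirlStabilizer.mp ((Subgroup.eq_top_iff' _).mp hD g)]
  simp [this]

theorem twirl_haarSU_of_invariant {D : Superop n} (hD : twirlStabilizer (suChannel n) D = ⊤) :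
    twirl (suChannel n) (haarSU n) D = D := by
  rw [twirl_haarSU_apply]
  simp [fun g => mem_twirlStabilizer.mp ((Subgroup.eq_top_iff' _).mp hD g)]

/-! ### Strict contraction -/

/-- The variance identity: the norm lost by averaging vectors of equal length is their variance. -/
theorem sum_smul_norm_sub_sq {ι E : Type*} [Fintype ι] [NormedAddCommGroup E]
    [InnerProductSpace ℝ E] {p : ι → ℝ} (hp : ∑ i, p i = 1) {x : ι → E} {r : ℝ}
    (hx : ∀ i, ‖x i‖ = r) :
    ∑ i, p i * ‖x i - ∑ j, p j • x j‖ ^ 2 = r ^ 2 - ‖∑ j, p j • x j‖ ^ 2 := by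
  set w := ∑ j, p j • x j with hw
  have h1 : ∀ i, p i * ‖x i - w‖ ^ 2 =
      p i * r ^ 2 - 2 * inner ℝ (p i • x i) w + p i * ‖w‖ ^ 2 := by
    intro i
    rw [norm_sub_sq_real, hx, real_inner_smul_left]
    ring
  simp only [h1]
  rw [Finset.sum_add_distrib, Finset.sum_sub_distrib, ← Finset.sum_mul, ← Finset.sum_mul, hp,
    ← Finset.mul_sum, ← sum_inner, ← hw, real_inner_self_eq_norm_sq]
  ring

theorem ContinuousLinearMap.norm_lt_one_of_forall_lt {E : Type*} [NormedAddCommGroup E]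
    [NormedSpace ℝ E] [FiniteDimensional ℝ E] (T : E →L[ℝ] E) (h : ∀ v, v ≠ 0 → ‖T v‖ < ‖v‖) :
    ‖T‖ < 1 := by
  have := FiniteDimensional.proper ℝ E
  obtain ⟨v, hv, hmax⟩ := (isCompact_closedBall (0 : E) 1).exists_isMaxOn
    (Metric.nonempty_closedBall.mpr zero_le_one) (f := fun v => ‖T v‖) (by fun_prop)
  have hle : ‖T‖ ≤ ‖T v‖ := T.opNorm_le_of_unit_norm (norm_nonneg _) fun x hx =>
    hmax (mem_closedBall_zero_iff.mpr hx.le)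
  refine hle.trans_lt ?_
  -- If the maximum is attained at `0`, the operator norm is `0`.
  by_cases h0 : v = 0
  · simp [h0]
  · exact (h v h0).trans_le (mem_closedBall_zero_iff.mp hv)

theorem twirl_of_finite {G : Type*} [Group G] [Fintype G] [MeasurableSpace G]
    [MeasurableSingletonClass G] (ω : G →* Module.End ℝ (Herm n)) (μ : Measure G)
    [IsFiniteMeasure μ] (C : Superop n) : twirl ω μ C = ∑ g, μ.real {g} • twirlAt ω g C := by
  rw [twirl, integral_fintype Integrable.of_finite, sum_apply]
  rfl

/-- If a strongly scrambling measure on a finite group does not shrink `C` under twirling, then `C`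
is invariant under the group. -/
theorem twirlStabilizer_eq_top_of_norm_le {G : Type*} [Group G] [Fintype G] [MeasurableSpace G]
    [MeasurableSingletonClass G] {ω : G →* Module.End ℝ (Herm n)}
    (hω : ∀ g, ∃ u : U n, ω g = channel n u) (μ : Measure G) [IsProbabilityMeasure μ]
    (hμ : StronglyScrambling μ) {C : Superop n} (hC : ‖C‖ ≤ ‖twirl ω μ C‖) :
    twirlStabilizer ω C = ⊤ := by
  have hp : ∑ g, μ.real {g} = 1 := by
    rw [sum_measureReal_singleton, Finset.coe_univ, probReal_univ]
  have hsum := sum_smul_norm_sub_sq hp (fun g => norm_twirlAt hω g C)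
  rw [← twirl_of_finite] at hsum
  have hnonneg : ∀ g ∈ Finset.univ, 0 ≤ μ.real {g} * ‖twirlAt ω g C - twirl ω μ C‖ ^ 2 :=
    fun g _ => by positivity
  have hzero : ∑ g, μ.real {g} * ‖twirlAt ω g C - twirl ω μ C‖ ^ 2 = 0 := by
    refine le_antisymm ?_ (Finset.sum_nonneg hnonneg)
    rw [hsum]
    have := pow_le_pow_left₀ (norm_nonneg C) hC 2
    linarith
  have hall : ∀ g, μ {g} ≠ 0 → twirlAt ω g C = twirl ω μ C := by
    intro g hg
    have h1 := (Finset.sum_eq_zero_iff_of_nonneg hnonneg).mp hzero g (Finset.mem_univ g)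
    have h2 : μ.real {g} ≠ 0 := (measureReal_ne_zero_iff).mpr hg
    simpa [h2, sub_eq_zero] using h1
  obtain ⟨a, ha⟩ : ∃ a, μ {a} ≠ 0 := by
    by_contra! h
    simp [Measure.real, h] at hp
  by_contra hne
  -- Zero variance makes all support twirls of `C` agree, which puts the support in the right coset
  -- of the stabilizer through `a`.
  refine (hμ _ hne a).2 fun b hb => ⟨b * a⁻¹, ?_, by group⟩
  rw [mem_twirlStabilizer, twirlAt_mul, hall b hb, ← hall a ha, ← twirlAt_mul, mul_inv_cancel,
    twirlAt_one]

end CliffordTwirl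

theorem mainTheorem2 (n : ℕ) (μ : Measure (CliffordGroup n)) [IsProbabilityMeasure μ]
    (hμ : StronglyScrambling μ) :
    ‖twirl (cliffordChannel n) μ - twirl (suChannel n) (haarSU n)‖ < 1 := by
  have := Fintype.ofFinite (CliffordGroup n)
  have : MeasurableSingletonClass (CliffordGroup n) := ⟨fun _ => trivial⟩
  set T := twirl (cliffordChannel n) μ with hT
  set P := twirl (suChannel n) (haarSU n) with hP
  have hp : ∑ g, μ.real {g} = 1 := by
    rw [sum_measureReal_singleton, Finset.coe_univ, probReal_univ]
  refine ContinuousLinearMap.norm_lt_one_of_forall_lt _ fun v hv => ?_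
  have hinv := twirlStabilizer_twirl_haarSU v
  rw [← hP] at hinv
  have hTP : T (P v) = P v := by
    have hcl := twirlStabilizer_clifford_eq_top_iff.mpr hinv
    rw [hT, twirl_of_finite]
    simp only [fun g => mem_twirlStabilizer.mp ((Subgroup.eq_top_iff' _).mp hcl g)]
    rw [← Finset.sum_smul, hp, one_smul]
  have hPP : P (v - P v) = 0 := by
    rw [map_sub, hP, twirl_haarSU_of_invariant hinv, sub_self]
  have happ : (T - P) v = T (v - P v) := by
    rw [sub_apply, map_sub, hTP]
  have horth : inner ℝ (P v) (v - P v) = 0 := by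
    rw [inner_sub_right, ← inner_twirl_haarSU hinv v, sub_self]
  have hpyth : ‖v - P v‖ ≤ ‖v‖ := by
    have h := norm_add_sq_eq_norm_sq_add_norm_sq_of_inner_eq_zero _ _ horth
    rw [add_sub_cancel] at h
    nlinarith [norm_nonneg v, norm_nonneg (v - P v), mul_self_nonneg ‖P v‖]
  rw [happ]
  by_contra! hle
  -- The negated bound gives `‖v - P v‖ ≤ ‖v‖ ≤ ‖T (v - P v)‖`, the equality case of the
  -- contraction.
  have hfix := twirlStabilizer_clifford_eq_top_iff.mp
    (twirlStabilizer_eq_top_of_norm_le cliffordChannel_eq_channel μ hμ (hpyth.trans hle))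
  have hzero : v - P v = 0 := by
    rw [← twirl_haarSU_of_invariant hfix, ← hP, hPP]
  rw [hzero, map_zero, norm_zero] at hle
  exact hv (norm_le_zero_iff.mp hle)
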